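/- A permutation of size $k$ (a $k$-point permutation) is a bijection $\pi:[k]\to[k]$, where $[k]=\{1,\dots,k\}$; write $|\pi|=k$. For $A=\{a_1<\dots<a_k\}\subseteq[n]$ and a permutation $\pi$ of size $n$, the subpermutation of $\pi$ induced by $A$ is the unique permutation $\sigma$ of size $k$ with $\sigma(i)<\sigma(j)\iff\pi(a_i)<\pi(a_j)$ for all $i,j\in[k]$. The density $d(\sigma,\pi)$ is the probability that a uniformly random $|\sigma|$-element subset of $[|\pi|]$ induces $\sigma$ in $\pi$, and $d(\sigma,\pi)=0$ if $|\sigma|>|\pi|$. A sequence $(\tau_n)_{n\in\mathbb N}$ of permutations is quasirandom if $\lim_{n\to\infty} d(\sigma,\tau_n)=1/|\sigma|!$ for every permutation $\sigma$. A set $Z$ of permutations is quasirandom-forcing if every sequence $(\tau_n)_{n\in\mathbb N}$ of permutations with $|\tau_n|\to\infty$ is quasirandom if and only if $\lim_{n\to\infty} d(\sigma,\tau_n)=1/|\sigma|!$ for every $\sigma\in Z$. The permutation matrix $A_\pi$ of a permutation $\pi$ of size $k$ is the $k\times k$ matrix whose entry in row $i$ and column $\pi(i)$ is $1$ for every $i\in[k]$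 and whose other entries are $0$. **Theorem.** Let $\pi_1,\pi_2,\pi_3,\pi_4$ be four distinct $4$-point permutations such that the set $\{\pi_1,\pi_2,\pi_3,\pi_4\}$ is quasirandom-forcing. Then either $A_{\pi_1}+A_{\pi_2}+A_{\pi_3}+A_{\pi_4}$ is the $4\times4$ matrix all of whose entries are $1$, or, possibly after relabelling the four permutations, $A_{\pi_1}+A_{\pi_2}-A_{\pi_3}-A_{\pi_4}$ is the zero matrix. -/

import Mathlib

open Filter Topology

namespace PermQR

/-- A finite permutation: a size `n` together with a permutation of an `n`-element chain. -/
abbrev FinPerm : Type := Σ n : ℕ, Equiv.Perm (Fin n)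

/-- The subpermutation of `π` induced by the set `A` of positions is `σ`: the set `A` has `k`
elements `a 0 < ⋯ < a (k - 1)`, and `σ i < σ j` if and only if `π (a i) < π (a j)`. -/
def Induces {n k : ℕ} (π : Equiv.Perm (Fin n)) (A : Finset (Fin n)) (σ : Equiv.Perm (Fin k)) :
    Prop :=
  ∃ h : A.card = k, ∀ i j : Fin k,
    σ i < σ j ↔ π (A.orderEmbOfFin h i) < π (A.orderEmbOfFin h j)

instance {n k : ℕ} (π : Equiv.Perm (Fin n)) (A : Finset (Fin n)) (σ : Equiv.Perm (Fin k)) :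
    Decidable (Induces π A σ) :=
  inferInstanceAs (Decidable (∃ h : A.card = k, ∀ i j : Fin k,
    σ i < σ j ↔ π (A.orderEmbOfFin h i) < π (A.orderEmbOfFin h j)))

/-- The pattern density of `σ` in `π`: the probability that a uniformly random `|σ|`-element set
of positions of `π` induces `σ`, and zero if `|σ| > |π|`. -/
noncomputable def density (σ π : FinPerm) : ℝ :=
  if σ.1 ≤ π.1 then
    (((Finset.univ.powersetCard σ.1).filter (fun A => Induces π.2 A σ.2)).card : ℝ)
      / (π.1.choose σ.1 : ℝ)
  else 0

/-- The density of the permutation `σ` in the sequence `s` converges to `1 / |σ|!`. -/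
def HasRandomDensity (s : ℕ → FinPerm) (σ : FinPerm) : Prop :=
  Tendsto (fun n => density σ (s n)) atTop (𝓝 (1 / (σ.1.factorial : ℝ)))

/-- A sequence of permutations is quasirandom if the density of every permutation `σ` in it
converges to `1 / |σ|!`. -/
def IsQuasirandom (s : ℕ → FinPerm) : Prop :=
  ∀ σ : FinPerm, HasRandomDensity s σ

/-- A set `Z` of permutations is quasirandom-forcing if a sequence of permutations whose sizes
tend to infinity is quasirandom exactly when the density of every element `σ` of `Z` in it
converges to `1 / |σ|!`. -/
def QuasirandomForcing (Z : Set FinPerm) : Prop :=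
  ∀ s : ℕ → FinPerm, Tendsto (fun n => (s n).1) atTop atTop →
    (IsQuasirandom s ↔ ∀ σ ∈ Z, HasRandomDensity s σ)

/-- The permutation matrix of `π`: the entry in row `i` and column `π i` is one and all other
entries are zero. -/
abbrev permMat {k : ℕ} (π : Equiv.Perm (Fin k)) : Matrix (Fin k) (Fin k) ℝ :=
  π.permMatrix ℝ

end PermQR

namespace PermQR

open Finset

/-! The proof is a perturbation of the uniform measure. Let a polynomial density `W` on the unit
square, of degree at most 3 in each variable, be close to 1 and of mass 1; its marginals need not be
uniform, since patterns depend only on order. The density of `σ`, with `|σ| = m`, among random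
points is `m! * limitCount σ W`, and `exists_seq_tendsto_density` realises these values as limits
along permutations.

For 4-point `σ`, the derivative of `limitCount σ` at the uniform density in the direction `x ^ k * y
^ l` is the `(k, l)` entry of `Vᵀ A_σ V`, with `V = momentMatrix` invertible; the derivative of the
mass is `36 Vᵀ J V`, with `J` the all-ones matrix. So linear relations between derivatives are
exactly relations between permutation matrices and `J`.

If `J` and the four given matrices are independent, some `A_τ` lies outside their span, as
permutation matrices span more than five dimensions. Lagrange multipliers then give `W` near 1 with
the four prescribed densities exact and that of `τ` wrong, so the set is not forcing. Hence a
forcing set carries a nontrivial relation, and looking at single entries shows that it has one of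
the two stated forms. -/

/-! ### Growth of sums of powers -/

theorem tendsto_succ_pow_sub_pow_div (d : ℕ) :
    Tendsto (fun n : ℕ => (((n : ℝ) + 1) ^ (d + 1) - (n : ℝ) ^ (d + 1)) / (n : ℝ) ^ d) atTop
      (𝓝 ((d : ℝ) + 1)) := by
  have h1 : Tendsto (fun n : ℕ => (((n : ℝ) + 1) / n)) atTop (𝓝 1) := by
    have := (tendsto_one_div_atTop_nhds_zero_nat (𝕜 := ℝ)).const_add 1
    rw [add_zero] at this
    refine this.congr' ?_
    filter_upwards [eventually_gt_atTop 0] with n hn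
    field_simp
  have h2 : Tendsto (fun n : ℕ => ∑ j ∈ range (d + 1), (((n : ℝ) + 1) / n) ^ j) atTop
      (𝓝 (∑ j ∈ range (d + 1), (1 : ℝ) ^ j)) :=
    tendsto_finsetSum _ fun j _ => h1.pow j
  have h3 : (∑ j ∈ range (d + 1), (1 : ℝ) ^ j) = d + 1 := by simp
  rw [h3] at h2
  refine h2.congr' ?_
  filter_upwards [eventually_gt_atTop 0] with n hn
  have hn' : (n : ℝ) ≠ 0 := by positivity
  have := (Commute.all ((n : ℝ) + 1) n).geom_sum₂_mul (d + 1)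
  rw [← this, add_sub_cancel_left, mul_one, sum_div]
  refine sum_congr rfl fun j hj => ?_
  rw [mem_range] at hj
  have : (n : ℝ) ^ d = n ^ j * n ^ (d + 1 - 1 - j) := by
    rw [← pow_add]; congr 1; omega
  rw [this, div_pow]
  field_simp

/-- Summation raises the order of growth of a sequence by one. -/
theorem tendsto_sum_range_div_pow {a : ℕ → ℝ} {d : ℕ} {c : ℝ}
    (ha : Tendsto (fun n : ℕ => a n / (n : ℝ) ^ d) atTop (𝓝 c)) :
    Tendsto (fun n : ℕ => (∑ i ∈ range n, a i) / (n : ℝ) ^ (d + 1)) atTop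
      (𝓝 (c * (1 / ((d : ℝ) + 1)))) := by
  set g : ℕ → ℝ := fun n => ((n : ℝ) + 1) ^ (d + 1) - (n : ℝ) ^ (d + 1) with hg
  have hgpos : ∀ n, 0 < g n := fun n => by
    have : (n : ℝ) ^ (d + 1) < ((n : ℝ) + 1) ^ (d + 1) :=
      pow_lt_pow_left₀ (by linarith) (by positivity) (by omega)
    simp only [hg]; linarith
  have hsum : ∀ n, ∑ i ∈ range n, g i = (n : ℝ) ^ (d + 1) := fun n => by
    have := sum_range_sub (fun i : ℕ => (i : ℝ) ^ (d + 1)) n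
    simpa [hg] using this
  set c' := c * (1 / ((d : ℝ) + 1)) with hc'
  have hlim : Tendsto (fun n => a n / g n) atTop (𝓝 c') := by
    have := ha.div (tendsto_succ_pow_sub_pow_div d) (by positivity)
    rw [hc', mul_one_div]
    refine this.congr' ?_
    filter_upwards [eventually_gt_atTop 0] with n hn
    have hn' : (n : ℝ) ≠ 0 := by positivity
    simp only [Pi.div_apply, hg]
    field_simp
  -- Stolz–Cesàro: the error is `o(g)` with `g` positive and of divergent sum, so its partial sums
  -- are `o(n ^ (d + 1))`, the sums of `g` telescoping.
  have ho : (fun n => a n - c' * g n) =o[atTop] g := by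
    rw [Asymptotics.isLittleO_iff_tendsto (fun n h => absurd h (hgpos n).ne')]
    have := hlim.sub_const c'
    rw [sub_self] at this
    refine this.congr fun n => ?_
    have := (hgpos n).ne'
    field_simp
  have hs := ho.sum_range (fun n => (hgpos n).le) (by
    simp only [hsum]
    exact (tendsto_pow_atTop (by omega)).comp tendsto_natCast_atTop_atTop)
  simp only [hsum] at hs
  have ht := hs.tendsto_div_nhds_zero.add_const c'
  rw [zero_add] at ht
  refine ht.congr' ?_
  filter_upwards [eventually_gt_atTop 0] with n hn
  have hn' : (n : ℝ) ≠ 0 := by positivity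
  rw [sum_sub_distrib, ← mul_sum, hsum]
  field_simp
  ring

/-! ### Monomial sums over increasing sequences -/

/-- Sequences of length `m` with values below `N`, strictly increasing if `δ = 0` and weakly
increasing if `δ = 1`. -/
def chains (δ m N : ℕ) : Finset (Fin m → ℕ) :=
  (Fintype.piFinset fun _ => range N).filter fun f => ∀ r s, r < s → f r < f s + δ

theorem mem_chains {δ m N : ℕ} {f : Fin m → ℕ} :
    f ∈ chains δ m N ↔ (∀ r, f r < N) ∧ ∀ r s, r < s → f r < f s + δ := by
  simp [chains]

/-- Split off the last entry `i`: the earlier ones are below `i` in the strict case and at most `i`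
in the weak one, that is, below `i + δ`. -/
theorem sum_chains_succ {δ m N : ℕ} (hδ : δ ≤ 1) (F : (Fin (m + 1) → ℕ) → ℝ) :
    ∑ f ∈ chains δ (m + 1) N, F f =
      ∑ i ∈ range N, ∑ g ∈ chains δ m (i + δ), F (Fin.snoc g i) := by
  rw [sum_sigma']
  refine sum_bij' (fun f _ => ⟨f (Fin.last m), fun r => f r.castSucc⟩)
    (fun p _ => Fin.snoc p.2 p.1) ?_ ?_ ?_ ?_ ?_
  · intro f hf
    rw [mem_chains] at hf
    simp only [mem_sigma, mem_range, mem_chains]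
    exact ⟨hf.1 _, fun r => hf.2 _ _ (Fin.castSucc_lt_last r),
      fun r s hrs => hf.2 _ _ (Fin.castSucc_lt_castSucc_iff.2 hrs)⟩
  · rintro ⟨i, g⟩ h
    simp only [mem_sigma, mem_range, mem_chains] at h
    rw [mem_chains]
    refine ⟨fun r => ?_, fun r s hrs => ?_⟩
    · refine Fin.lastCases ?_ (fun r => ?_) r
      · simpa using h.1
      · have := h.2.1 r
        simp only [Fin.snoc_castSucc]; omega
    · revert hrs
      refine Fin.lastCases (fun hrs => ?_) (fun s => ?_) s
      · revert hrs
        refine Fin.lastCases (fun hrs => ?_) (fun r _ => ?_) r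
        · exact absurd hrs (lt_irrefl _)
        · simpa using h.2.1 r
      · refine Fin.lastCases (fun hrs => ?_) (fun r hrs => ?_) r
        · exact absurd hrs (Fin.castSucc_lt_last s).not_gt
        · simpa using h.2.2 r s (Fin.castSucc_lt_castSucc_iff.1 hrs)
  · intro f _
    exact Fin.snoc_init_self f
  · rintro ⟨i, g⟩ _
    simp
  · intro f _
    congr 1
    exact (Fin.snoc_init_self f).symm

/-- The integral of `∏ r, x r ^ k r` over `0 ≤ x 0 ≤ ⋯ ≤ x (m - 1) ≤ 1`. -/
noncomputable def chainConst {m : ℕ} (k : Fin m → ℕ) : ℝ :=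
  ∏ r : Fin m, (1 / (((r : ℕ) : ℝ) + 1 + ((∑ s ∈ Iic r, k s : ℕ) : ℝ)))

theorem chainConst_snoc {m : ℕ} (k : Fin (m + 1) → ℕ) :
    chainConst k = chainConst (fun r => k r.castSucc) *
      (1 / ((m + (∑ r : Fin m, k r.castSucc) + k (Fin.last m) : ℕ) + 1 : ℝ)) := by
  unfold chainConst
  rw [Fin.prod_univ_castSucc]
  congr 1
  · refine prod_congr rfl fun r _ => ?_
    have : Iic r.castSucc = (Iic r).map Fin.castSuccEmb := by
      ext x
      refine Fin.lastCases ?_ (fun x => ?_) x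
      · simp [(Fin.castSucc_lt_last _).ne]
      · simp
    rw [this, sum_map]
    simp
  · have : Iic (Fin.last m) = univ := by ext x; simp [Fin.le_last]
    rw [this, Fin.sum_univ_castSucc]
    push_cast
    congr 1
    ring

/-- These are Riemann sums of the integral `chainConst k`, evaluated one variable at a time. Ties
are negligible, so both values of `δ` give the same limit; this is what closes the later sandwich.
-/
theorem tendsto_sum_chains {δ : ℕ} (hδ : δ ≤ 1) {m : ℕ} (k : Fin m → ℕ) :
    Tendsto (fun N : ℕ => (∑ f ∈ chains δ m N, ∏ r, (f r : ℝ) ^ k r) /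
      (N : ℝ) ^ (m + ∑ r, k r)) atTop (𝓝 (chainConst k)) := by
  induction m with
  | zero =>
    have : ∀ N, chains δ 0 N = univ := fun N => by
      ext f; simp only [mem_chains, mem_univ, iff_true]; exact ⟨fun r => r.elim0, fun r => r.elim0⟩
    simp [this, chainConst]
  | succ m ih =>
    set k' : Fin m → ℕ := fun r => k r.castSucc with hk'
    set e := m + ∑ r, k' r with he
    have h1 := (ih k').comp (tendsto_add_atTop_nat δ)
    have h2 : Tendsto (fun n : ℕ => (((n + δ : ℕ) : ℝ) / n) ^ e) atTop (𝓝 1) := by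
      have := ((tendsto_const_div_atTop_nhds_zero_nat (δ : ℝ)).const_add 1).pow e
      rw [add_zero, one_pow] at this
      refine this.congr' ?_
      filter_upwards [eventually_gt_atTop 0] with n hn
      push_cast
      congr 1
      field_simp
    have h3 : Tendsto (fun n : ℕ => ((∑ g ∈ chains δ m (n + δ), ∏ r, (g r : ℝ) ^ k' r) *
        (n : ℝ) ^ k (Fin.last m)) / (n : ℝ) ^ (e + k (Fin.last m))) atTop (𝓝 (chainConst k')) := by
      have := h1.mul h2
      rw [mul_one] at this
      refine this.congr' ?_
      filter_upwards [eventually_gt_atTop 0] with n hn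
      have hn' : (n : ℝ) ≠ 0 := by positivity
      have hn'' : ((n + δ : ℕ) : ℝ) ≠ 0 := by positivity
      simp only [Function.comp]
      rw [← he, div_pow]
      field_simp
      ring
    have h4 := tendsto_sum_range_div_pow h3
    rw [chainConst_snoc]
    refine h4.congr fun N => ?_
    rw [sum_chains_succ hδ]
    have hexp : m + 1 + ∑ r, k r = e + k (Fin.last m) + 1 := by
      rw [Fin.sum_univ_castSucc, he, hk']; dsimp only; omega
    rw [hexp]
    congr 1
    refine sum_congr rfl fun i _ => ?_
    rw [sum_mul]
    refine sum_congr rfl fun g _ => ?_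
    rw [Fin.prod_univ_castSucc]
    simp [hk']

/-! ### Weighted pattern counts and their limits -/

/-- The polynomial with coefficients `W`, of degree at most three in each variable. -/
def weight (W : Fin 4 × Fin 4 → ℝ) (x y : ℝ) : ℝ :=
  ∑ p, W p * (x ^ (p.1 : ℕ) * y ^ (p.2 : ℕ))

/-- The total weight `∏ r, c (x r) (y r)` of the ways to place the pattern `σ` with positions `f`
and values `g` in the `N × N` grid. -/
def weightedCount (δ : ℕ) {m : ℕ} (σ : Equiv.Perm (Fin m)) (N : ℕ) (c : ℕ → ℕ → ℝ) : ℝ :=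
  ∑ f ∈ chains δ m N, ∑ g ∈ chains δ m N, ∏ r, c (f r) (g (σ r))

/-- The total weight of the occurrences of `σ` among `m` points in the unit square, the square
carrying the density `weight W`. -/
noncomputable def limitCount {m : ℕ} (σ : Equiv.Perm (Fin m)) (W : Fin 4 × Fin 4 → ℝ) : ℝ :=
  ∑ κ : Fin m → Fin 4 × Fin 4,
    chainConst (fun r => ((κ r).1 : ℕ)) * chainConst (fun r => ((κ (σ.symm r)).2 : ℕ)) *
      ∏ r, W (κ r)

/-- Expanding the product chooses a monomial `κ r` for each point, after which the sums over
positions and over values separate. The `r`-th lowest point is the `σ.symm r`-th from the left,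
whence the index of the second factor. -/
theorem weightedCount_weight (δ : ℕ) {m : ℕ} (σ : Equiv.Perm (Fin m)) {N : ℕ} (hN : 0 < N)
    (W : Fin 4 × Fin 4 → ℝ) :
    weightedCount δ σ N (fun i j => weight W (i / N) (j / N)) / (N : ℝ) ^ (2 * m) =
      ∑ κ : Fin m → Fin 4 × Fin 4,
        ((∑ f ∈ chains δ m N, ∏ r, (f r : ℝ) ^ ((κ r).1 : ℕ)) /
            (N : ℝ) ^ (m + ∑ r, ((κ r).1 : ℕ))) *
          ((∑ g ∈ chains δ m N, ∏ r, (g r : ℝ) ^ ((κ (σ.symm r)).2 : ℕ)) /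
            (N : ℝ) ^ (m + ∑ r, ((κ (σ.symm r)).2 : ℕ))) * ∏ r, W (κ r) := by
  have hN' : (N : ℝ) ≠ 0 := by positivity
  have key : ∀ f g : Fin m → ℕ, ∏ r, weight W ((f r : ℝ) / N) ((g (σ r) : ℝ) / N) =
      ∑ κ : Fin m → Fin 4 × Fin 4,
        ((∏ r, (f r : ℝ) ^ ((κ r).1 : ℕ)) / (N : ℝ) ^ (∑ r, ((κ r).1 : ℕ))) *
          ((∏ r, (g r : ℝ) ^ ((κ (σ.symm r)).2 : ℕ)) /
            (N : ℝ) ^ (∑ r, ((κ (σ.symm r)).2 : ℕ))) * ∏ r, W (κ r) := by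
    intro f g
    unfold weight
    rw [Fintype.prod_sum]
    refine sum_congr rfl fun κ _ => ?_
    have h1 : (∏ r, (g r : ℝ) ^ ((κ (σ.symm r)).2 : ℕ)) /
        (N : ℝ) ^ (∑ r, ((κ (σ.symm r)).2 : ℕ)) = ∏ r, ((g (σ r) : ℝ) / N) ^ ((κ r).2 : ℕ) := by
      rw [← prod_pow_eq_pow_sum, ← prod_div_distrib,
        ← Equiv.prod_comp σ (fun r => (g r : ℝ) ^ ((κ (σ.symm r)).2 : ℕ) / _)]
      simp [div_pow]
    rw [h1, ← prod_pow_eq_pow_sum, ← prod_div_distrib, ← prod_mul_distrib, ← prod_mul_distrib]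
    refine prod_congr rfl fun r _ => ?_
    rw [div_pow]
    ring
  unfold weightedCount
  simp only [key]
  rw [sum_congr rfl fun f _ => sum_comm, sum_comm, sum_div]
  refine sum_congr rfl fun κ _ => ?_
  simp only [← sum_mul, ← mul_sum, ← sum_div]
  rw [pow_add, pow_add, two_mul, pow_add]
  field_simp

/-- The coefficients may vary with `N` so that rounding errors can be absorbed into them. -/
theorem tendsto_weightedCount {δ : ℕ} (hδ : δ ≤ 1) {m : ℕ} (σ : Equiv.Perm (Fin m))
    {W : ℕ → Fin 4 × Fin 4 → ℝ} {W₀ : Fin 4 × Fin 4 → ℝ} (hW : Tendsto W atTop (𝓝 W₀)) :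
    Tendsto (fun N : ℕ => weightedCount δ σ N (fun i j => weight (W N) (i / N) (j / N)) /
      (N : ℝ) ^ (2 * m)) atTop (𝓝 (limitCount σ W₀)) := by
  have : Tendsto (fun N : ℕ => ∑ κ : Fin m → Fin 4 × Fin 4,
        ((∑ f ∈ chains δ m N, ∏ r, (f r : ℝ) ^ ((κ r).1 : ℕ)) /
            (N : ℝ) ^ (m + ∑ r, ((κ r).1 : ℕ))) *
          ((∑ g ∈ chains δ m N, ∏ r, (g r : ℝ) ^ ((κ (σ.symm r)).2 : ℕ)) /
            (N : ℝ) ^ (m + ∑ r, ((κ (σ.symm r)).2 : ℕ))) * ∏ r, W N (κ r)) atTop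
      (𝓝 (limitCount σ W₀)) :=
    tendsto_finsetSum _ fun κ _ => ((tendsto_sum_chains hδ _).mul (tendsto_sum_chains hδ _)).mul
      (tendsto_finsetProd _ fun r _ => (tendsto_pi_nhds.1 hW) (κ r))
  refine this.congr' ?_
  filter_upwards [eventually_gt_atTop 0] with N hN
  rw [weightedCount_weight δ σ hN]

theorem weightedCount_mono {δ m : ℕ} (σ : Equiv.Perm (Fin m)) {N : ℕ} {c c' : ℕ → ℕ → ℝ}
    (h0 : ∀ i < N, ∀ j < N, 0 ≤ c i j) (h : ∀ i < N, ∀ j < N, c i j ≤ c' i j) :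
    weightedCount δ σ N c ≤ weightedCount δ σ N c' := by
  refine sum_le_sum fun f hf => sum_le_sum fun g hg => prod_le_prod ?_ ?_
  all_goals
    intro r _
    have h1 := (mem_chains.1 hf).1 r
    have h2 := (mem_chains.1 hg).1 (σ r)
  · exact h0 _ h1 _ h2
  · exact h _ h1 _ h2

theorem weightedCount_mul_left {δ m : ℕ} (σ : Equiv.Perm (Fin m)) {N : ℕ} (a : ℝ)
    (c : ℕ → ℕ → ℝ) :
    weightedCount δ σ N (fun i j => a * c i j) = a ^ m * weightedCount δ σ N c := by
  simp [weightedCount, prod_mul_distrib, mul_sum]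

/-! ### Permutations from planar point sets -/

theorem exists_equiv_strictMono {P α : Type*} [Fintype P] [LinearOrder α] {x : P → α}
    (hx : Function.Injective x) {M : ℕ} (hM : Fintype.card P = M) :
    ∃ e : Fin M ≃ P, StrictMono (x ∘ e) := by
  let _ : LinearOrder P := LinearOrder.lift' x hx
  exact ⟨(monoEquivOfFin P hM).toEquiv, fun i j h => (monoEquivOfFin P hM).strictMono h⟩

theorem lt_iff_lt_iff_strictMono {α : Type*} [LinearOrder α] {k : ℕ} (σ : Equiv.Perm (Fin k))
    (u : Fin k → α) : (∀ i j, σ i < σ j ↔ u i < u j) ↔ StrictMono (u ∘ σ.symm) := by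
  constructor
  · intro h i j hij
    simpa [h] using (h (σ.symm i) (σ.symm j)).1 (by simpa using hij)
  · intro h i j
    simpa using (h.lt_iff_lt (a := σ i) (b := σ j)).symm

open Classical in
/-- The occurrences of the pattern `σ` among the points of `P`, ordered horizontally by `x` and
vertically by `y`. -/
noncomputable def occurrences {X α β : Type*} [LinearOrder α] [LinearOrder β] (P : Finset X)
    (x : X → α) (y : X → β) {m : ℕ} (σ : Equiv.Perm (Fin m)) : Finset (Fin m → X) :=
  (Fintype.piFinset fun _ => P).filter fun f => StrictMono (x ∘ f) ∧ StrictMono (y ∘ f ∘ σ.symm)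

/-- A finite set of points with distinct abscissae and distinct ordinates defines a permutation. -/
theorem exists_perm_card_filter_induces {X α β : Type*} [LinearOrder α] [LinearOrder β]
    (P : Finset X) (x : X → α) (y : X → β) (hx : Set.InjOn x P) (hy : Set.InjOn y P) :
    ∃ π : Equiv.Perm (Fin #P), ∀ (m : ℕ) (σ : Equiv.Perm (Fin m)),
      #{A ∈ powersetCard m univ | Induces π A σ} = #(occurrences P x y σ) := by
  obtain ⟨e, he⟩ := exists_equiv_strictMono (P := P) (x := fun p => x p) hx.injective
    (M := #P) (by simp)
  obtain ⟨e', he'⟩ := exists_equiv_strictMono (P := P) (x := fun p => y p) hy.injective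
    (M := #P) (by simp)
  have hlt : ∀ i j, (e.trans e'.symm) i < (e.trans e'.symm) j ↔ y (e i) < y (e j) := fun i j => by
    rw [← he'.lt_iff_lt]; simp
  refine ⟨e.trans e'.symm, fun m σ => ?_⟩
  have hcond : ∀ (A : Finset (Fin #P)) (h : #A = m),
      Induces (e.trans e'.symm) A σ ↔
        StrictMono (y ∘ (fun r => (e (A.orderEmbOfFin h r) : X)) ∘ σ.symm) := fun A h => by
    rw [← Function.comp_assoc, ← lt_iff_lt_iff_strictMono]
    simp only [Induces, h, exists_true_left, hlt, Function.comp]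
  refine card_bij (fun A hA r => (e (A.orderEmbOfFin (k := m)
    (mem_powersetCard.1 (mem_filter.1 hA).1).2 r) : X)) ?_ ?_ ?_
  · intro A hA
    have hc : #A = m := (mem_powersetCard.1 (mem_filter.1 hA).1).2
    have hi := (mem_filter.1 hA).2
    simp only [occurrences, mem_filter, Fintype.mem_piFinset]
    exact ⟨fun r => coe_mem _, fun r s hrs => he ((A.orderEmbOfFin hc).strictMono hrs),
      (hcond A hc).1 hi⟩
  · intro A hA B hB hAB
    have hA' : #A = m := (mem_powersetCard.1 (mem_filter.1 hA).1).2
    have hB' : #B = m := (mem_powersetCard.1 (mem_filter.1 hB).1).2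
    have : ⇑(A.orderEmbOfFin hA') = ⇑(B.orderEmbOfFin hB') := by
      funext r
      exact e.injective (Subtype.ext (congrFun hAB r))
    rw [← coe_inj, ← range_orderEmbOfFin A hA', ← range_orderEmbOfFin B hB', this]
  · intro f hf
    simp only [occurrences, mem_filter, Fintype.mem_piFinset] at hf
    obtain ⟨hP, hxf, hyf⟩ := hf
    set u : Fin m → Fin #P := fun r => e.symm ⟨f r, hP r⟩ with hu
    have heu : ∀ r, (e (u r) : X) = f r := fun r => by simp [hu]
    have hmono : StrictMono u := fun r s hrs => by
      rw [← he.lt_iff_lt]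
      simpa [heu] using hxf hrs
    have hc : #(univ.image u) = m := by
      rw [card_image_of_injective _ hmono.injective, card_univ, Fintype.card_fin]
    have hord : u = (univ.image u).orderEmbOfFin hc :=
      orderEmbOfFin_unique hc (fun r => mem_image_of_mem _ (mem_univ r)) hmono
    have hfu : (fun r => (e ((univ.image u).orderEmbOfFin hc r) : X)) = f := by
      funext r
      rw [← hord, heu]
    refine ⟨univ.image u, ?_, hfu⟩
    rw [mem_filter, mem_powersetCard, hcond _ hc, hfu]
    exact ⟨⟨subset_univ _, hc⟩, hyf⟩

/-! ### Points on a grid with multiplicities -/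

/-- The points of the `N × N` grid, with `c i j` copies of the point `(i, j)`. -/
def gridPoints (N : ℕ) (c : ℕ → ℕ → ℕ) : Finset (Σ _ : ℕ × ℕ, ℕ) :=
  (range N ×ˢ range N).sigma fun p => range (c p.1 p.2)

/-- The horizontal position of a point: ties between columns are broken by the rows. -/
def abscissa (p : Σ _ : ℕ × ℕ, ℕ) : ℕ ×ₗ (ℕ ×ₗ ℕ) := toLex (p.1.1, toLex (p.1.2, p.2))

/-- The vertical position of a point: ties between rows are broken by the columns. -/
def ordinate (p : Σ _ : ℕ × ℕ, ℕ) : ℕ ×ₗ (ℕ ×ₗ ℕ) := toLex (p.1.2, toLex (p.1.1, p.2))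

theorem abscissa_injective : Function.Injective abscissa := by
  rintro ⟨⟨i, j⟩, l⟩ ⟨⟨i', j'⟩, l'⟩ h
  simp only [abscissa, EmbeddingLike.apply_eq_iff_eq, Prod.mk.injEq] at h
  obtain ⟨rfl, rfl, rfl⟩ := h
  rfl

theorem ordinate_injective : Function.Injective ordinate := by
  rintro ⟨⟨i, j⟩, l⟩ ⟨⟨i', j'⟩, l'⟩ h
  simp only [ordinate, EmbeddingLike.apply_eq_iff_eq, Prod.mk.injEq] at h
  obtain ⟨rfl, rfl, rfl⟩ := h
  rfl

/-- The placements of `σ` among the points of a grid, ties being forbidden if `δ = 0` and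
admissible if `δ = 1`. -/
def placements (δ : ℕ) {m : ℕ} (σ : Equiv.Perm (Fin m)) (N : ℕ) (c : ℕ → ℕ → ℕ) :
    Finset (Fin m → Σ _ : ℕ × ℕ, ℕ) :=
  (Fintype.piFinset fun _ => gridPoints N c).filter fun f => ∀ r s, r < s →
    (f r).1.1 < (f s).1.1 + δ ∧ (f (σ.symm r)).1.2 < (f (σ.symm s)).1.2 + δ

/-- Strictly increasing first coordinates decide the lexicographic order without any tie-breaking.
-/
theorem placements_zero_subset {m : ℕ} (σ : Equiv.Perm (Fin m)) (N : ℕ) (c : ℕ → ℕ → ℕ) :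
    placements 0 σ N c ⊆ occurrences (gridPoints N c) abscissa ordinate σ := by
  intro f hf
  rw [placements, mem_filter] at hf
  rw [occurrences, mem_filter]
  refine ⟨hf.1, fun r s hrs => ?_, fun r s hrs => ?_⟩
  · exact Prod.Lex.toLex_lt_toLex.2 (Or.inl (hf.2 r s hrs).1)
  · exact Prod.Lex.toLex_lt_toLex.2 (Or.inl (hf.2 r s hrs).2)

theorem occurrences_subset_placements_one {m : ℕ} (σ : Equiv.Perm (Fin m)) (N : ℕ)
    (c : ℕ → ℕ → ℕ) :
    occurrences (gridPoints N c) abscissa ordinate σ ⊆ placements 1 σ N c := by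
  intro f hf
  rw [occurrences, mem_filter] at hf
  rw [placements, mem_filter]
  refine ⟨hf.1, fun r s hrs => ⟨?_, ?_⟩⟩
  · exact Nat.lt_succ_of_le (Prod.Lex.toLex_lt_toLex'.1 (hf.2.1 hrs)).1
  · exact Nat.lt_succ_of_le (Prod.Lex.toLex_lt_toLex'.1 (hf.2.2 hrs)).1

/-- The placements with prescribed columns and rows form a product of cells, the `r`-th point
ranging over the copies of one grid point. -/
theorem card_placements (δ : ℕ) {m : ℕ} (σ : Equiv.Perm (Fin m)) (N : ℕ) (c : ℕ → ℕ → ℕ) :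
    (#(placements δ σ N c) : ℝ) = weightedCount δ σ N (fun i j => c i j) := by
  have hfib : ∀ i < N, ∀ j < N, #{p ∈ gridPoints N c | p.1 = (i, j)} = c i j := by
    intro i hi j hj
    have : {p ∈ gridPoints N c | p.1 = (i, j)} =
        (range (c i j)).image fun l => (⟨(i, j), l⟩ : Σ _ : ℕ × ℕ, ℕ) := by
      ext ⟨⟨i', j'⟩, l⟩
      simp only [gridPoints, mem_filter, mem_sigma, mem_product, mem_range, mem_image]
      constructor
      · rintro ⟨⟨_, hl⟩, h⟩
        cases h
        exact ⟨l, hl, rfl⟩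
      · rintro ⟨l', hl, h⟩
        cases h
        exact ⟨⟨⟨hi, hj⟩, hl⟩, rfl⟩
    rw [this, card_image_of_injective _ (fun l l' h => by cases h; rfl), card_range]
  have hmaps : Set.MapsTo (fun f : Fin m → Σ _ : ℕ × ℕ, ℕ =>
      ((fun r => (f r).1.1, fun r => (f (σ.symm r)).1.2) : (Fin m → ℕ) × (Fin m → ℕ)))
      (placements δ σ N c) (chains δ m N ×ˢ chains δ m N : Finset _) := by
    intro f hf
    rw [mem_coe, placements, mem_filter, Fintype.mem_piFinset] at hf
    simp only [gridPoints, mem_sigma, mem_product, mem_range] at hf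
    rw [mem_coe, mem_product, mem_chains, mem_chains]
    exact ⟨⟨fun r => (hf.1 r).1.1, fun r s h => (hf.2 r s h).1⟩,
      ⟨fun r => (hf.1 _).1.2, fun r s h => (hf.2 r s h).2⟩⟩
  rw [card_eq_sum_card_fiberwise hmaps, sum_product, weightedCount, Nat.cast_sum]
  refine sum_congr rfl fun u hu => ?_
  rw [Nat.cast_sum]
  refine sum_congr rfl fun v hv => ?_
  rw [mem_chains] at hu hv
  have : {f ∈ placements δ σ N c |
      ((fun r => (f r).1.1, fun r => (f (σ.symm r)).1.2) : (Fin m → ℕ) × (Fin m → ℕ)) = (u, v)} =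
      Fintype.piFinset fun r => {p ∈ gridPoints N c | p.1 = (u r, v (σ r))} := by
    ext f
    simp only [placements, mem_filter, Fintype.mem_piFinset, Prod.ext_iff]
    constructor
    · rintro ⟨⟨hP, _⟩, h1, h2⟩ r
      refine ⟨hP r, congrFun h1 r, ?_⟩
      simpa using congrFun h2 (σ r)
    · intro h
      have h1 : ∀ r, (f r).1.1 = u r := fun r => (h r).2.1
      have h2 : ∀ r, (f (σ.symm r)).1.2 = v r := fun r => by simpa using (h (σ.symm r)).2.2
      refine ⟨⟨fun r => (h r).1, fun r s hrs => ?_⟩, funext h1, funext h2⟩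
      rw [h1, h1, h2, h2]
      exact ⟨hu.2 r s hrs, hv.2 r s hrs⟩
  rw [this, Fintype.card_piFinset, Nat.cast_prod]
  exact prod_congr rfl fun r _ => by rw [hfib _ (hu.1 r) _ (hv.1 _)]

/-! ### Permutations converging to a polynomial density -/

/-- The base coefficients: those of the constant density `1`. -/
def unitCoeff : Fin 4 × Fin 4 → ℝ := Pi.single 0 1

theorem weight_sub_smul (W : Fin 4 × Fin 4 → ℝ) (a x y : ℝ) :
    weight (W - a • unitCoeff) x y = weight W x y - a := by
  simp [weight, sub_mul, sum_sub_distrib, unitCoeff, Pi.single_apply]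

/-- If `weight W` is positive on the unit square, then the occurrences of `σ` among the points of a
fine grid with multiplicities proportional to `weight W` are governed by `limitCount σ W`. -/
theorem tendsto_card_occurrences {W : Fin 4 × Fin 4 → ℝ} {b : ℝ} (hb : 0 < b)
    (hW : ∀ x ∈ Set.Icc (0 : ℝ) 1, ∀ y ∈ Set.Icc (0 : ℝ) 1, b ≤ weight W x y)
    {m : ℕ} (σ : Equiv.Perm (Fin m)) :
    Tendsto (fun N : ℕ => (#(occurrences (gridPoints N fun i j => ⌊N * weight W (i / N) (j / N)⌋₊)
      abscissa ordinate σ) : ℝ) / (N : ℝ) ^ (3 * m)) atTop (𝓝 (limitCount σ W)) := by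
  -- Since `⌊N * w⌋₊ ≥ N * (w - 1 / N)`, lowering the constant coefficient by `1 / N` gives a lower
  -- bound; strict and weak placements then squeeze the count.
  have hlow : Tendsto (fun N : ℕ => W - (1 / (N : ℝ)) • unitCoeff) atTop (𝓝 W) := by
    have := ((tendsto_one_div_atTop_nhds_zero_nat (𝕜 := ℝ)).smul_const unitCoeff).const_sub W
    rwa [zero_smul, sub_zero] at this
  refine tendsto_of_tendsto_of_tendsto_of_le_of_le'
    (tendsto_weightedCount (δ := 0) zero_le_one σ hlow)
    (tendsto_weightedCount (δ := 1) le_rfl σ (tendsto_const_nhds (x := W))) ?_ ?_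
  all_goals
    have hev : ∀ᶠ N : ℕ in atTop, 1 / (N : ℝ) < b :=
      (tendsto_one_div_atTop_nhds_zero_nat (𝕜 := ℝ)).eventually_lt_const hb
    filter_upwards [eventually_gt_atTop 0, hev] with N hN hNb
    have hN' : (0 : ℝ) < N := by positivity
    have hdiv : ∀ i < N, (i : ℝ) / N ∈ Set.Icc (0 : ℝ) 1 := fun i hi =>
      ⟨by positivity, (div_le_one hN').2 (by exact_mod_cast hi.le)⟩
    -- `N ^ m` comes from the multiplicities, `N ^ (2 * m)` from the choice of columns and rows.
    have hexp : (N : ℝ) ^ (3 * m) = N ^ m * N ^ (2 * m) := by rw [← pow_add]; congr 1; omega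
    rw [hexp, ← div_div]
    refine div_le_div_of_nonneg_right ?_ (by positivity)
  · rw [le_div_iff₀' (by positivity), ← weightedCount_mul_left]
    refine le_trans ?_ (Nat.cast_le.2 (card_le_card (placements_zero_subset σ N _)))
    rw [card_placements]
    refine weightedCount_mono σ (fun i hi j hj => ?_) fun i hi j hj => ?_
    all_goals
      have := hW _ (hdiv i hi) _ (hdiv j hj)
      rw [weight_sub_smul]
    -- Monotonicity of the products needs nonnegative lower weights; this is where `1 / N < b`
    -- enters.
    · exact mul_nonneg hN'.le (by linarith)
    · rw [mul_sub, mul_one_div_cancel hN'.ne']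
      linarith [Nat.lt_floor_add_one ((N : ℝ) * weight W (i / N) (j / N))]
  · rw [div_le_iff₀' (by positivity), ← weightedCount_mul_left]
    refine (Nat.cast_le.2 (card_le_card (occurrences_subset_placements_one σ N _))).trans ?_
    rw [card_placements]
    refine weightedCount_mono σ (fun i hi j hj => by positivity) fun i hi j hj => ?_
    have := hW _ (hdiv i hi) _ (hdiv j hj)
    exact Nat.floor_le (mul_nonneg hN'.le (by linarith))

/-- A density of total mass one that is positive on the unit square is the limit of permutations. -/
theorem exists_seq_tendsto_density {W : Fin 4 × Fin 4 → ℝ} {b : ℝ} (hb : 0 < b)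
    (hW : ∀ x ∈ Set.Icc (0 : ℝ) 1, ∀ y ∈ Set.Icc (0 : ℝ) 1, b ≤ weight W x y)
    (hone : limitCount (1 : Equiv.Perm (Fin 1)) W = 1) :
    ∃ s : ℕ → FinPerm, Tendsto (fun n => (s n).1) atTop atTop ∧
      ∀ (m : ℕ) (σ : Equiv.Perm (Fin m)), Tendsto (fun n => density ⟨m, σ⟩ (s n)) atTop
        (𝓝 (m.factorial * limitCount σ W)) := by
  set P : ℕ → Finset (Σ _ : ℕ × ℕ, ℕ) := fun N =>
    gridPoints N fun i j => ⌊N * weight W (i / N) (j / N)⌋₊ with hP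
  choose π hπ using fun N => exists_perm_card_filter_induces (P N) abscissa ordinate
    abscissa_injective.injOn ordinate_injective.injOn
  have hcard : Tendsto (fun N : ℕ => (#(P N) : ℝ) / (N : ℝ) ^ 3) atTop (𝓝 1) := by
    have := tendsto_card_occurrences hb hW (1 : Equiv.Perm (Fin 1))
    rw [hone] at this
    refine this.congr fun N => ?_
    congr 2
    change #(occurrences (P N) abscissa ordinate 1) = _
    have : occurrences (P N) abscissa ordinate (1 : Equiv.Perm (Fin 1)) =
        Fintype.piFinset fun _ => P N :=
      filter_true_of_mem fun f _ => ⟨Subsingleton.strictMono _, Subsingleton.strictMono _⟩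
    rw [this]
    simp [Fintype.card_piFinset]
  have hcube : Tendsto (fun N : ℕ => (N : ℝ) ^ 3) atTop atTop :=
    (tendsto_pow_atTop (by norm_num)).comp tendsto_natCast_atTop_atTop
  have htop : Tendsto (fun N => #(P N)) atTop atTop := by
    rw [← tendsto_natCast_atTop_iff (R := ℝ)]
    refine (hcard.pos_mul_atTop one_pos hcube).congr' ?_
    filter_upwards [eventually_gt_atTop 0] with N hN
    field_simp
  refine ⟨fun N => ⟨#(P N), π N⟩, htop, fun m σ => ?_⟩
  have hchoose : Tendsto (fun N => ((#(P N)).choose m : ℝ) / (N : ℝ) ^ (3 * m)) atTop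
      (𝓝 (1 / m.factorial)) := by
    have h1 : Tendsto (fun n : ℕ => (n.choose m : ℝ) / (n : ℝ) ^ m) atTop
        (𝓝 (1 / m.factorial)) := by
      have h := (isEquivalent_choose m).div
        (Asymptotics.IsEquivalent.refl (u := fun n : ℕ => (n : ℝ) ^ m))
      refine h.tendsto_nhds_iff.2 (tendsto_const_nhds.congr' ?_)
      filter_upwards [eventually_gt_atTop 0] with n hn
      simp only [Pi.div_apply]
      field_simp
    have := (h1.comp htop).mul (hcard.pow m)
    rw [one_pow, mul_one] at this
    refine this.congr' ?_
    filter_upwards [htop.eventually_gt_atTop 0, eventually_gt_atTop 0] with N hN hN'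
    simp only [Function.comp, div_pow, pow_mul]
    field_simp
  have := (tendsto_card_occurrences hb hW σ).div hchoose (by positivity)
  rw [div_div_eq_mul_div, div_one, mul_comm (limitCount σ W)] at this
  refine this.congr' ?_
  filter_upwards [htop.eventually_ge_atTop m, eventually_gt_atTop 0] with N hN hN'
  have hN'' : (N : ℝ) ≠ 0 := by positivity
  simp only [density, hN, if_true, hπ, Pi.div_apply]
  rw [div_div_div_cancel_right₀ (by positivity)]

/-! ### First-order expansion at the uniform density -/

/-- The first-order moments of the `r`-th smallest of `m` points. -/
noncomputable def moment {m : ℕ} (r : Fin m) (k : ℕ) : ℝ := chainConst (Pi.single r k)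

theorem moment_eq {m : ℕ} (r : Fin m) (k : ℕ) :
    moment r k = ∏ s : Fin m, (1 / (((s : ℕ) : ℝ) + 1 + ((if r ≤ s then k else 0 : ℕ) : ℝ))) := by
  unfold moment chainConst
  refine prod_congr rfl fun s _ => ?_
  rw [sum_pi_single']
  simp

/-- The derivative of `limitCount σ` at the uniform density. -/
noncomputable def limitCountDeriv {m : ℕ} (σ : Equiv.Perm (Fin m)) :
    (Fin 4 × Fin 4 → ℝ) →L[ℝ] ℝ :=
  ∑ r, ∑ p : Fin 4 × Fin 4,
    (moment r p.1 * moment (σ r) p.2) • ContinuousLinearMap.proj (R := ℝ) (φ := fun _ => ℝ) p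

theorem hasStrictFDerivAt_limitCount {m : ℕ} (σ : Equiv.Perm (Fin m)) :
    HasStrictFDerivAt (limitCount σ) (limitCountDeriv σ) unitCoeff := by
  have h : HasStrictFDerivAt (limitCount σ) (∑ κ : Fin m → Fin 4 × Fin 4,
      (chainConst (fun r => ((κ r).1 : ℕ)) * chainConst (fun r => ((κ (σ.symm r)).2 : ℕ))) •
        ∑ r, (∏ s ∈ univ.erase r, unitCoeff (κ s)) •
          ContinuousLinearMap.proj (R := ℝ) (φ := fun _ : Fin 4 × Fin 4 => ℝ) (κ r))
      unitCoeff := by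
    unfold limitCount
    refine HasStrictFDerivAt.fun_sum fun κ _ => HasStrictFDerivAt.const_mul ?_ _
    exact HasStrictFDerivAt.finsetProd fun r _ => hasStrictFDerivAt_apply (κ r) unitCoeff
  refine h.congr_fderiv (ContinuousLinearMap.ext fun H => ?_)
  simp only [limitCountDeriv, _root_.sum_apply, smul_apply,
    ContinuousLinearMap.proj_apply, smul_eq_mul, mul_sum]
  rw [sum_comm]
  refine sum_congr rfl fun r _ => ?_
  symm
  -- Only the constant coefficient of `unitCoeff` is nonzero, so a term survives only if `κ`
  -- vanishes away from `r`.
  refine sum_of_injOn (fun p => Function.update 0 r p)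
    ((Function.update_injective (0 : Fin m → Fin 4 × Fin 4) r).injOn) (fun _ _ => mem_univ _) ?_ ?_
  · intro κ _ hκ
    have : ∃ s, s ≠ r ∧ κ s ≠ 0 := by
      by_contra! hcon
      refine hκ ⟨κ r, mem_univ _, ?_⟩
      funext s
      by_cases hs : s = r
      · subst hs; simp
      · simp [hs, hcon s hs]
    obtain ⟨s, hs, h0⟩ := this
    rw [prod_eq_zero (i := s) (by simp [hs]) (by simp [unitCoeff, h0])]
    ring
  · intro p _
    have h1 : (fun s => ((Function.update (0 : Fin m → Fin 4 × Fin 4) r p s).1 : ℕ)) =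
        Pi.single r (p.1 : ℕ) := by
      funext s
      by_cases hs : s = r
      · subst hs; simp
      · simp [hs]
    have h2 : (fun s => ((Function.update (0 : Fin m → Fin 4 × Fin 4) r p (σ.symm s)).2 : ℕ)) =
        Pi.single (σ r) (p.2 : ℕ) := by
      funext s
      by_cases hs : s = σ r
      · subst hs; simp
      · have : σ.symm s ≠ r := fun h => hs (by simp [← h])
        simp [hs, this]
    have h3 : ∏ s ∈ univ.erase r,
        unitCoeff (Function.update (0 : Fin m → Fin 4 × Fin 4) r p s) = 1 :=
      prod_eq_one fun s hs => by simp [unitCoeff, (mem_erase.1 hs).1]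
    rw [h1, h2, h3]
    simp [moment]

theorem limitCount_unitCoeff {m : ℕ} (σ : Equiv.Perm (Fin m)) :
    limitCount σ unitCoeff = 1 / (m.factorial : ℝ) ^ 2 := by
  have h0 : chainConst (fun _ : Fin m => 0) = 1 / (m.factorial : ℝ) := by
    unfold chainConst
    rw [prod_div_distrib, prod_const_one]
    congr 1
    rw [← prod_range_add_one_eq_factorial, ← Fin.prod_univ_eq_prod_range (fun i => i + 1) m]
    push_cast
    simp
  unfold limitCount
  rw [sum_eq_single 0]
  · simp [unitCoeff, h0]
    ring
  · intro κ _ hκ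
    obtain ⟨s, hs⟩ := Function.ne_iff.1 hκ
    rw [prod_eq_zero (mem_univ s) (by simpa [unitCoeff, Pi.single_apply] using hs), mul_zero]
  · simp

/-- The matrix of the first-order moments of four points. -/
noncomputable def momentMatrix : Matrix (Fin 4) (Fin 4) ℝ := Matrix.of fun r k => moment r k

/-- Column `k` is a multiple of `(r + 1) ⋯ (r + k)`, a polynomial of degree `k` in `r`, so this is a
Vandermonde matrix up to column operations. Degree 3 in each variable is chosen to make it square.
-/
theorem isUnit_momentMatrix : IsUnit momentMatrix := by
  rw [Matrix.isUnit_iff_isUnit_det, isUnit_iff_ne_zero]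
  have : momentMatrix = !![1/24, 1/120, 1/360, 1/840; 1/24, 1/60, 1/120, 1/210;
      1/24, 1/40, 1/60, 1/84; 1/24, 1/30, 1/36, 1/42] := by
    ext r k
    fin_cases r <;> fin_cases k <;>
      simp [momentMatrix, moment_eq, Fin.prod_univ_four] <;> norm_num
  rw [this]
  simp [Matrix.det_succ_row_zero, Fin.sum_univ_succ, Fin.succAbove]
  norm_num

theorem limitCountDeriv_single {m : ℕ} (σ : Equiv.Perm (Fin m)) (k l : Fin 4) :
    limitCountDeriv σ (Pi.single (k, l) 1) = ∑ r, moment r k * moment (σ r) l := by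
  simp only [limitCountDeriv, _root_.sum_apply, smul_apply, ContinuousLinearMap.proj_apply,
    smul_eq_mul]
  refine sum_congr rfl fun r _ => ?_
  rw [sum_eq_single (k, l)]
  · simp
  · intro p _ hp
    simp [hp]
  · simp

theorem limitCountDeriv_single_eq (σ : Equiv.Perm (Fin 4)) (k l : Fin 4) :
    limitCountDeriv σ (Pi.single (k, l) 1) =
      (momentMatrix.transpose * permMat σ * momentMatrix : Matrix _ _ ℝ) k l := by
  rw [limitCountDeriv_single, Matrix.mul_assoc, Matrix.mul_apply, permMat,
    Equiv.Perm.permMatrix, PEquiv.toMatrix_toPEquiv_mul]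
  rfl

/-- Summing over ranks forgets the order: the result is the integral of `x ^ k` times the volume `1
/ 3!` of the simplex of the other three points. -/
theorem sum_moment (k : ℕ) : ∑ r : Fin 4, moment r k = 1 / 6 * moment (0 : Fin 1) k := by
  simp only [moment_eq, Fin.sum_univ_four, Fin.prod_univ_four]
  simp [show ¬ (3 : Fin 4) ≤ 2 by decide, show ¬ (3 : Fin 4) ≤ 1 by decide,
    show ¬ (2 : Fin 4) ≤ 1 by decide, show (1 : Fin 4) ≤ 2 by decide,
    show (1 : Fin 4) ≤ 3 by decide, show (2 : Fin 4) ≤ 3 by decide]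
  have : (0 : ℝ) ≤ k := by positivity
  field_simp
  ring

theorem limitCountDeriv_one_single_eq (k l : Fin 4) :
    limitCountDeriv (1 : Equiv.Perm (Fin 1)) (Pi.single (k, l) 1) =
      36 * (momentMatrix.transpose * Matrix.of (fun _ _ => (1 : ℝ)) * momentMatrix :
        Matrix (Fin 4) (Fin 4) ℝ) k l := by
  have h1 : (momentMatrix.transpose * Matrix.of (fun _ _ => (1 : ℝ)) * momentMatrix :
      Matrix (Fin 4) (Fin 4) ℝ) k l =
      (∑ r : Fin 4, moment r k) * ∑ r : Fin 4, moment r l := by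
    simp only [Matrix.mul_apply, Matrix.transpose_apply, Matrix.of_apply, mul_one, momentMatrix,
      mul_sum]
  rw [h1, sum_moment, sum_moment, limitCountDeriv_single]
  simp
  ring

/-! ### Lagrange multipliers -/

/-- If the permutation matrices of `π 0, …, π 3`, `τ` and the all-ones matrix are linearly
independent, the limit densities of `π 0, …, π 3` do not determine that of `τ` near the uniform
density. -/
theorem exists_limitCount_ne (π : Fin 4 → Equiv.Perm (Fin 4)) (τ : Equiv.Perm (Fin 4))
    (hind : ∀ (t : Fin 4 → ℝ) (a c : ℝ), ∑ i, t i • permMat (π i) + a • permMat τ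
      + c • Matrix.of (fun _ _ => (1 : ℝ)) = 0 → t = 0 ∧ a = 0 ∧ c = 0)
    {U : Set (Fin 4 × Fin 4 → ℝ)} (hU : U ∈ 𝓝 unitCoeff) :
    ∃ W ∈ U, limitCount (1 : Equiv.Perm (Fin 1)) W = 1 ∧
      (∀ i, limitCount (π i) W = 1 / 24 ^ 2) ∧ limitCount τ W ≠ 1 / 24 ^ 2 := by
  by_contra! hcon
  set f : Option (Fin 4) → (Fin 4 × Fin 4 → ℝ) → ℝ := fun o => o.elim
    (limitCount (1 : Equiv.Perm (Fin 1))) (fun i => limitCount (π i)) with hf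
  set f' : Option (Fin 4) → (Fin 4 × Fin 4 → ℝ) →L[ℝ] ℝ := fun o => o.elim
    (limitCountDeriv (1 : Equiv.Perm (Fin 1))) (fun i => limitCountDeriv (π i)) with hf'
  have hderiv : ∀ o, HasStrictFDerivAt (f o) (f' o) unitCoeff := by
    rintro (_ | i) <;> exact hasStrictFDerivAt_limitCount _
  -- If the claim fails, `limitCount τ` is constant on the constraint set near `unitCoeff`, hence
  -- trivially extremal there.
  have hext : IsLocalExtrOn (limitCount τ) {W | ∀ o, f o W = f o unitCoeff} unitCoeff := by
    left
    have h1 : ∀ᶠ W in 𝓝[{W | ∀ o, f o W = f o unitCoeff}] unitCoeff, W ∈ U :=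
      mem_nhdsWithin_of_mem_nhds hU
    filter_upwards [h1, self_mem_nhdsWithin] with W hWU hW
    have h4 : ((Nat.factorial 4 : ℕ) : ℝ) = 24 := by norm_num [Nat.factorial]
    have := hcon W hWU ((hW none).trans (by simp [hf, limitCount_unitCoeff]))
      fun i => (hW (some i)).trans (by simp [hf, limitCount_unitCoeff, h4])
    rw [this, limitCount_unitCoeff, h4]
  obtain ⟨Λ, a, hne, hrel⟩ :=
    hext.exists_multipliers_of_hasStrictFDerivAt hderiv (hasStrictFDerivAt_limitCount τ)
  rw [Fintype.sum_option] at hrel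
  set S : Matrix (Fin 4) (Fin 4) ℝ := ∑ i, Λ (some i) • permMat (π i) + a • permMat τ
      + (36 * Λ none) • Matrix.of (fun _ _ => (1 : ℝ)) with hS
  have hzero : momentMatrix.transpose * S * momentMatrix = 0 := by
    ext k l
    have := DFunLike.congr_fun hrel (Pi.single (k, l) 1)
    simp only [add_apply, smul_apply, _root_.sum_apply, hf', Option.elim, zero_apply,
      limitCountDeriv_single_eq, limitCountDeriv_one_single_eq, smul_eq_mul] at this
    rw [hS]
    simp only [Matrix.mul_add, Matrix.add_mul, Matrix.mul_sum, Matrix.sum_mul, Matrix.mul_smul,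
      Matrix.smul_mul, Matrix.add_apply, Matrix.sum_apply, Matrix.smul_apply, smul_eq_mul,
      Matrix.zero_apply]
    linarith
  -- Cancelling the invertible moment matrices turns the relation between derivatives into one
  -- between matrices.
  have hSz : S = 0 := by
    have hV := isUnit_momentMatrix
    have hVt : IsUnit momentMatrix.transpose := by
      rw [Matrix.isUnit_iff_isUnit_det, Matrix.det_transpose, ← Matrix.isUnit_iff_isUnit_det]
      exact hV
    rw [hV.mul_left_eq_zero, hVt.mul_right_eq_zero] at hzero
    exact hzero
  obtain ⟨h1, h2, h3⟩ := hind _ _ _ hSz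
  refine hne (Prod.ext (funext fun o => ?_) h2)
  rcases o with _ | i
  · simpa using h3
  · exact congrFun h1 i

theorem permMat_apply {k : ℕ} (π : Equiv.Perm (Fin k)) (r s : Fin k) :
    permMat π r s = if π r = s then 1 else 0 := by
  simp [permMat, eq_comm]

theorem exists_nhds_half_le_weight : ∃ U ∈ 𝓝 unitCoeff, ∀ W ∈ U, ∀ x ∈ Set.Icc (0 : ℝ) 1,
    ∀ y ∈ Set.Icc (0 : ℝ) 1, 1 / 2 ≤ weight W x y := by
  -- Each of the 16 coefficients moves the weight by at most `1 / 32`, in total by at most `1 / 2`.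
  refine ⟨Metric.ball unitCoeff (1 / 32), Metric.ball_mem_nhds _ (by norm_num), ?_⟩
  intro W hW x hx y hy
  have hsplit : weight W x y = 1 + ∑ p : Fin 4 × Fin 4,
      (W p - unitCoeff p) * (x ^ (p.1 : ℕ) * y ^ (p.2 : ℕ)) := by
    simp only [sub_mul, sum_sub_distrib]
    simp [weight, unitCoeff, Pi.single_apply]
  have hterm : ∀ p : Fin 4 × Fin 4,
      -(1 / 32) ≤ (W p - unitCoeff p) * (x ^ (p.1 : ℕ) * y ^ (p.2 : ℕ)) := by
    intro p
    have h1 : |W p - unitCoeff p| ≤ 1 / 32 := by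
      rw [← Real.dist_eq]
      exact (dist_le_pi_dist _ _ p).trans (Metric.mem_ball.1 hW).le
    have h2 : |x ^ (p.1 : ℕ) * y ^ (p.2 : ℕ)| ≤ 1 := by
      rw [abs_of_nonneg (mul_nonneg (pow_nonneg hx.1 _) (pow_nonneg hy.1 _))]
      exact mul_le_one₀ (pow_le_one₀ hx.1 hx.2) (pow_nonneg hy.1 _) (pow_le_one₀ hy.1 hy.2)
    refine (abs_le.1 ?_).1
    rw [abs_mul]
    simpa using mul_le_mul h1 h2 (abs_nonneg _) (by norm_num)
  have := sum_le_sum fun p (_ : p ∈ (univ : Finset (Fin 4 × Fin 4))) => hterm p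
  rw [sum_const, card_univ, Fintype.card_prod, Fintype.card_fin] at this
  rw [hsplit]
  norm_num at this ⊢
  linarith

/-! ### Linear relations between permutation matrices -/

/-- In a row where two permutations differ, the other two must cancel their entries: either one hits
each column, or one of the two columns carries a single coefficient, which is then zero. -/
theorem eq_zero_or_add_eq_zero_of_separated {ti tj tk tl : ℝ} {i j k l : Fin 4} (hij : i ≠ j)
    (h : ∀ v, (if i = v then ti else 0) + (if j = v then tj else 0) + (if k = v then tk else 0)
      + (if l = v then tl else 0) = 0) :
    ti = 0 ∨ tj = 0 ∨ (ti + tk = 0 ∧ tj + tl = 0) ∨ (ti + tl = 0 ∧ tj + tk = 0) := by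
  have h1 := h i
  have h2 := h j
  grind

/-- A linear relation between four distinct permutation matrices has coefficients
`u, u, -u, -u`. -/
theorem coeff_of_sum_permMat_eq_zero (π : Fin 4 → Equiv.Perm (Fin 4))
    (hπ : Function.Injective π) (t : Fin 4 → ℝ) (h : ∑ i, t i • permMat (π i) = 0) :
    t = 0 ∨ ∃ e : Equiv.Perm (Fin 4), t (e 0) ≠ 0 ∧ t (e 1) = t (e 0) ∧ t (e 2) = -t (e 0) ∧
      t (e 3) = -t (e 0) := by
  have hentry : ∀ r s, (if π 0 r = s then t 0 else 0) + (if π 1 r = s then t 1 else 0) +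
      (if π 2 r = s then t 2 else 0) + (if π 3 r = s then t 3 else 0) = 0 := by
    intro r s
    have := congrFun (congrFun h r) s
    simpa [Matrix.sum_apply, permMat_apply, Fin.sum_univ_four, -PEquiv.toMatrix_toPEquiv_apply]
      using this
  have hsep : ∀ i j, i ≠ j → ∃ r, π i r ≠ π j r := by
    intro i j hij
    by_contra! hcon
    exact hij (hπ (Equiv.ext hcon))
  have htot : t 0 + t 1 + t 2 + t 3 = 0 := by
    have := sum_congr rfl fun s (_ : s ∈ (univ : Finset (Fin 4))) => hentry 0 s
    simpa [sum_add_distrib] using this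
  have h01 : t 0 = 0 ∨ t 1 = 0 ∨ (t 0 + t 2 = 0 ∧ t 1 + t 3 = 0) ∨
      (t 0 + t 3 = 0 ∧ t 1 + t 2 = 0) := by
    obtain ⟨r, hr⟩ := hsep 0 1 (by decide)
    exact eq_zero_or_add_eq_zero_of_separated hr fun v => by linarith [hentry r v]
  have h02 : t 0 = 0 ∨ t 2 = 0 ∨ (t 0 + t 1 = 0 ∧ t 2 + t 3 = 0) ∨
      (t 0 + t 3 = 0 ∧ t 2 + t 1 = 0) := by
    obtain ⟨r, hr⟩ := hsep 0 2 (by decide)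
    exact eq_zero_or_add_eq_zero_of_separated hr fun v => by linarith [hentry r v]
  have h03 : t 0 = 0 ∨ t 3 = 0 ∨ (t 0 + t 1 = 0 ∧ t 3 + t 2 = 0) ∨
      (t 0 + t 2 = 0 ∧ t 3 + t 1 = 0) := by
    obtain ⟨r, hr⟩ := hsep 0 3 (by decide)
    exact eq_zero_or_add_eq_zero_of_separated hr fun v => by linarith [hentry r v]
  have h12 : t 1 = 0 ∨ t 2 = 0 ∨ (t 1 + t 0 = 0 ∧ t 2 + t 3 = 0) ∨
      (t 1 + t 3 = 0 ∧ t 2 + t 0 = 0) := by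
    obtain ⟨r, hr⟩ := hsep 1 2 (by decide)
    exact eq_zero_or_add_eq_zero_of_separated hr fun v => by linarith [hentry r v]
  have h13 : t 1 = 0 ∨ t 3 = 0 ∨ (t 1 + t 0 = 0 ∧ t 3 + t 2 = 0) ∨
      (t 1 + t 2 = 0 ∧ t 3 + t 0 = 0) := by
    obtain ⟨r, hr⟩ := hsep 1 3 (by decide)
    exact eq_zero_or_add_eq_zero_of_separated hr fun v => by linarith [hentry r v]
  have h23 : t 2 = 0 ∨ t 3 = 0 ∨ (t 2 + t 0 = 0 ∧ t 3 + t 1 = 0) ∨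
      (t 2 + t 1 = 0 ∧ t 3 + t 0 = 0) := by
    obtain ⟨r, hr⟩ := hsep 2 3 (by decide)
    exact eq_zero_or_add_eq_zero_of_separated hr fun v => by linarith [hentry r v]
  have hfinish : t 0 = 0 → t 1 = 0 → t 2 = 0 → t 3 = 0 → t = 0 := by
    intro a b c d
    funext i
    fin_cases i <;> assumption
  by_cases z0 : t 0 = 0
  · left; grind
  by_cases z1 : t 1 = 0
  · left; grind
  by_cases z2 : t 2 = 0
  · left; grind
  by_cases z3 : t 3 = 0
  · left; grind
  right
  -- With no coefficient zero, every pair lies on opposite sides of a cancelling pairing, so at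
  -- least two of the three pairings cancel.
  have hcases : (t 1 = t 0 ∧ t 2 = -t 0 ∧ t 3 = -t 0) ∨ (t 2 = t 0 ∧ t 1 = -t 0 ∧ t 3 = -t 0) ∨
      (t 3 = t 0 ∧ t 1 = -t 0 ∧ t 2 = -t 0) := by grind
  rcases hcases with h | h | h
  · exact ⟨1, z0, h⟩
  · refine ⟨Equiv.swap 1 2, ?_⟩
    have e0 : Equiv.swap (1 : Fin 4) 2 0 = 0 := by decide
    have e1 : Equiv.swap (1 : Fin 4) 2 1 = 2 := by decide
    have e2 : Equiv.swap (1 : Fin 4) 2 2 = 1 := by decide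
    have e3 : Equiv.swap (1 : Fin 4) 2 3 = 3 := by decide
    rw [e0, e1, e2, e3]
    exact ⟨z0, h⟩
  · refine ⟨Equiv.swap 1 3, ?_⟩
    have e0 : Equiv.swap (1 : Fin 4) 3 0 = 0 := by decide
    have e1 : Equiv.swap (1 : Fin 4) 3 1 = 3 := by decide
    have e2 : Equiv.swap (1 : Fin 4) 3 2 = 2 := by decide
    have e3 : Equiv.swap (1 : Fin 4) 3 3 = 1 := by decide
    rw [e0, e1, e2, e3]
    exact ⟨z0, h.1, h.2.2, h.2.1⟩

/-- If four permutation matrices of order four span a nonzero multiple of the all-ones matrix,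
then they partition its entries. -/
theorem sum_permMat_eq_of_smul (π : Fin 4 → Equiv.Perm (Fin 4)) (t : Fin 4 → ℝ) {c : ℝ}
    (hc : c ≠ 0) (h : ∑ i, t i • permMat (π i) = c • Matrix.of (fun _ _ => (1 : ℝ))) :
    ∑ i, permMat (π i) = Matrix.of (fun _ _ => (1 : ℝ)) := by
  ext r s
  -- An entry missed by all four permutations would be 0, not `c`; four values covering four columns
  -- are distinct.
  have hsurj : Function.Surjective fun i => π i r := by
    intro s
    by_contra! hcon
    have := congrFun (congrFun h r) s
    simp [Matrix.sum_apply, hcon, -PEquiv.toMatrix_toPEquiv_apply] at this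
    exact hc this.symm
  have hbij : Function.Bijective fun i => π i r := Finite.surjective_iff_bijective.1 hsurj
  rw [Matrix.sum_apply]
  simp only [permMat_apply, Matrix.of_apply]
  rw [hbij.sum_comp fun v => if v = s then (1 : ℝ) else 0]
  simp

/-- Six independent permutation matrices suffice: each of the five transpositions used has an
off-diagonal entry that no other chosen matrix has, and then the identity is left. -/
theorem exists_permMat_notMem {S : Submodule ℝ (Matrix (Fin 4) (Fin 4) ℝ)}
    (hS : Module.finrank ℝ S < 6) : ∃ τ : Equiv.Perm (Fin 4), permMat τ ∉ S := by
  by_contra! hcon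
  set v : Fin 6 → Equiv.Perm (Fin 4) := ![1, Equiv.swap 0 1, Equiv.swap 0 2, Equiv.swap 0 3,
    Equiv.swap 1 2, Equiv.swap 1 3] with hv
  have hli : LinearIndependent ℝ fun i => permMat (v i) := by
    rw [Fintype.linearIndependent_iff]
    intro g hg
    have hentry : ∀ r s, ∑ i, (if v i r = s then g i else 0) = 0 := by
      intro r s
      have := congrFun (congrFun hg r) s
      simpa [Matrix.sum_apply, permMat_apply, -PEquiv.toMatrix_toPEquiv_apply] using this
    have h1 := hentry 0 1
    have h2 := hentry 0 2
    have h3 := hentry 0 3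
    have h4 := hentry 1 2
    have h5 := hentry 1 3
    have h6 := hentry 0 0
    simp [Fin.sum_univ_succ, hv, Equiv.swap_apply_def] at h1 h2 h3 h4 h5 h6
    rw [h4, h5, add_zero, add_zero] at h6
    intro i
    fin_cases i <;> assumption
  have hle : Submodule.span ℝ (Set.range fun i => permMat (v i)) ≤ S := by
    rw [Submodule.span_le]
    rintro _ ⟨i, rfl⟩
    exact hcon _
  have h := Submodule.finrank_mono hle
  rw [finrank_span_eq_card hli, Fintype.card_fin] at h
  omega

/-! ### Conclusion -/

/-- Four permutations whose matrices are linearly independent together with the all-ones matrix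
do not force quasirandomness. -/
theorem not_quasirandomForcing (π : Fin 4 → Equiv.Perm (Fin 4))
    (hind : ∀ (t : Fin 4 → ℝ) (c : ℝ),
      ∑ i, t i • permMat (π i) = c • Matrix.of (fun _ _ => (1 : ℝ)) → t = 0) :
    ¬ QuasirandomForcing (Set.range fun i => (⟨4, π i⟩ : FinPerm)) := by
  intro hforce
  set J : Matrix (Fin 4) (Fin 4) ℝ := Matrix.of (fun _ _ => (1 : ℝ)) with hJ
  set v : Option (Fin 4) → Matrix (Fin 4) (Fin 4) ℝ := fun o => o.elim J fun i => permMat (π i)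
    with hv
  have hcard : Module.finrank ℝ (Submodule.span ℝ (Set.range v)) < 6 :=
    (finrank_range_le_card (R := ℝ) v).trans_lt (by simp)
  obtain ⟨τ, hτ⟩ := exists_permMat_notMem hcard
  have hmem : ∀ o, v o ∈ Submodule.span ℝ (Set.range v) := fun o =>
    Submodule.subset_span ⟨o, rfl⟩
  obtain ⟨U, hU, hUW⟩ := exists_nhds_half_le_weight
  obtain ⟨W, hWU, hone, hπW, hτW⟩ := exists_limitCount_ne π τ (fun t a c h => by
    have ha : a = 0 := by
      by_contra ha
      refine hτ ((Submodule.smul_mem_iff _ ha).1 ?_)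
      have : a • permMat τ = -(∑ i, t i • permMat (π i) + c • J) := by
        rw [eq_neg_iff_add_eq_zero, ← h]; abel
      rw [this]
      exact neg_mem (add_mem (sum_mem fun i _ => Submodule.smul_mem _ _ (hmem (some i)))
        (Submodule.smul_mem _ _ (hmem none)))
    rw [ha, zero_smul, add_zero] at h
    have ht : t = 0 := hind t (-c) (by rw [neg_smul]; exact eq_neg_of_add_eq_zero_left h)
    refine ⟨ht, ha, ?_⟩
    have := congrFun (congrFun h 0) 0
    simpa [ht, hJ] using this) hU
  obtain ⟨s, hs, hdens⟩ := exists_seq_tendsto_density one_half_pos (hUW W hWU) hone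
  have h4 : ((Nat.factorial 4 : ℕ) : ℝ) = 24 := by norm_num [Nat.factorial]
  have hqr : IsQuasirandom s := (hforce s hs).2 (by
    rintro _ ⟨i, rfl⟩
    have := hdens 4 (π i)
    rw [hπW, h4] at this
    unfold HasRandomDensity
    dsimp only
    rw [h4]
    convert this using 2
    norm_num)
  have h1 := tendsto_nhds_unique (hqr ⟨4, τ⟩) (hdens 4 τ)
  dsimp only at h1
  rw [h4] at h1
  apply hτW
  linarith

end PermQR

theorem mainTheorem3 (π : Fin 4 → Equiv.Perm (Fin 4)) (hπ : Function.Injective π)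
    (hforce : PermQR.QuasirandomForcing (Set.range fun i => (⟨4, π i⟩ : PermQR.FinPerm))) :
    PermQR.permMat (π 0) + PermQR.permMat (π 1) + PermQR.permMat (π 2) + PermQR.permMat (π 3)
        = Matrix.of (fun _ _ => (1 : ℝ)) ∨
      ∃ e : Equiv.Perm (Fin 4),
        PermQR.permMat (π (e 0)) + PermQR.permMat (π (e 1))
          - PermQR.permMat (π (e 2)) - PermQR.permMat (π (e 3)) = 0 := by
  by_contra! hcon
  refine PermQR.not_quasirandomForcing π (fun t c h => ?_) hforce
  -- A relation without `J` gives the form `u, u, -u, -u`; one involving `J` forces the four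
  -- matrices to sum to `J`.
  by_cases hc : c = 0
  · rw [hc, zero_smul] at h
    rcases PermQR.coeff_of_sum_permMat_eq_zero π hπ t h with h0 | ⟨e, he0, he1, he2, he3⟩
    · exact h0
    · refine absurd ?_ (hcon.2 e)
      rw [← Equiv.sum_comp e, Fin.sum_univ_four, he1, he2, he3] at h
      refine (smul_eq_zero_iff_right he0).1 ?_
      rw [← h]
      module
  · refine absurd ?_ hcon.1
    rw [← PermQR.sum_permMat_eq_of_smul π t hc h, Fin.sum_univ_four]
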